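/- For elements $x,y$ of a group write $[x,y]=x^{-1}y^{-1}xy$, and call a group $G$ capable if $G\cong H/Z(H)$ for some group $H$. Let $p$ be an odd prime, let $r\geq 1$, and let $C_1,\ldots,C_r$ be cyclic groups generated by $x_1,\ldots,x_r$ respectively, where $x_i$ has order $p^{\alpha_i}$ and $1\leq\alpha_1\leq\alpha_2\leq\cdots\leq\alpha_r$. Let $F=C_1*\cdots*C_r$ be their free product, with lower central series $F_1=F$, $F_{n+1}=[F_n,F]$, and let $K=F/F_3$ be the $2$-nilpotent product of the $C_i$; write $x_i$ also for the image of $x_i$ in $K$. For each pair $1\leq i<j\leq r$ let $\beta_{ji}$ be an integer with $1\leq\beta_{ji}\leq\alpha_i$. Let $N$ be the subgroup of $K$ generated by the elements $[x_j,x_i]^{p^{\beta_{ji}}}$, $1\leq i<j\leq r$; it is central, hence normal in $K$. Let $G=K/N$. Then $G$ is capable if and only if $r>1$ and $\alpha_{r-1}=\alpha_r$. -/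

import Mathlib

universe u v

/-- A group `G` is capable if it is isomorphic to `H / Z(H)` for some group `H`.
Taking `H` in the universe of `G` is no restriction: if `H / Z(H) ≅ G`, the subgroup of `H` generated
by a set of coset representatives of `Z(H)` has the same central quotient, and its cardinality is
at most `max |G| ℵ₀`. -/
def IsCapable (G : Type u) [Group G] : Prop :=
  ∃ (H : Type u) (_ : Group H), Nonempty (G ≃* H ⧸ Subgroup.center H)

/-- The commutator `[x, y] = x⁻¹ y⁻¹ x y`. -/
def groupComm {G : Type u} [Group G] (x y : G) : G := x⁻¹ * y⁻¹ * x * y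

/-- The `k`-nilpotent product of a family of groups (each nilpotent of class at most `k`): `F / F_{k+1}`
with `F` the free product. In Mathlib's indexing the series starts with term `0`, equal to `F_1 = F`, so that
`F_{k+1}` is its term `k`. -/
abbrev NilpotentProduct (k : ℕ) {ι : Type v} (A : ι → Type u) [∀ i, Group (A i)] :
    Type (max v u) :=
  Monoid.CoprodI A ⧸ (⊤ : Subgroup (Monoid.CoprodI A)).lowerCentralSeries k

/-- The canonical map of a factor into the `k`-nilpotent product. -/
def NilpotentProduct.inc (k : ℕ) {ι : Type v} (A : ι → Type u) [∀ i, Group (A i)] (i : ι) :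
    A i →* NilpotentProduct k A :=
  (QuotientGroup.mk' ((⊤ : Subgroup (Monoid.CoprodI A)).lowerCentralSeries k)).comp Monoid.CoprodI.of

/-- The subgroup of the `2`-nilpotent product generated by the powers
`[x_j, x_i] ^ (p ^ β_{ji})` for `i < j`. -/
def commPowSubgroup (p : ℕ) {r : ℕ} {C : Fin r → Type u} [∀ i, Group (C i)] (x : ∀ i, C i)
    (β : Fin r → Fin r → ℕ) : Subgroup (NilpotentProduct 2 C) :=
  Subgroup.closure {g | ∃ i j : Fin r, i < j ∧
    g = groupComm (NilpotentProduct.inc 2 C j (x j)) (NilpotentProduct.inc 2 C i (x i))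
      ^ (p ^ β j i)}

theorem groupComm_mem_center {ι : Type v} (A : ι → Type u) [∀ i, Group (A i)]
    (a b : NilpotentProduct 2 A) : groupComm a b ∈ Subgroup.center (NilpotentProduct 2 A) := by
  obtain ⟨a, rfl⟩ := QuotientGroup.mk_surjective a
  obtain ⟨b, rfl⟩ := QuotientGroup.mk_surjective b
  have h1 : a⁻¹ * b⁻¹ * a * b ∈ (⊤ : Subgroup (Monoid.CoprodI A)).lowerCentralSeries 1 := by
    have := Subgroup.commutator_mem_commutator (Subgroup.mem_top a⁻¹) (Subgroup.mem_top b⁻¹)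
    simpa [commutatorElement_def] using this
  rw [Subgroup.mem_center_iff]
  intro g
  obtain ⟨g, rfl⟩ := QuotientGroup.mk_surjective g
  have h2 : (a⁻¹ * b⁻¹ * a * b)⁻¹ * g⁻¹ * (a⁻¹ * b⁻¹ * a * b)⁻¹⁻¹ * g⁻¹⁻¹ ∈
      (⊤ : Subgroup (Monoid.CoprodI A)).lowerCentralSeries 2 :=
    Subgroup.commutator_mem_commutator (inv_mem h1) (Subgroup.mem_top g⁻¹)
  change ((g * (a⁻¹ * b⁻¹ * a * b) : Monoid.CoprodI A) : NilpotentProduct 2 A)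
    = ((a⁻¹ * b⁻¹ * a * b * g : Monoid.CoprodI A) : NilpotentProduct 2 A)
  rw [QuotientGroup.eq]
  have h3 : (g * (a⁻¹ * b⁻¹ * a * b))⁻¹ * (a⁻¹ * b⁻¹ * a * b * g) =
      (a⁻¹ * b⁻¹ * a * b)⁻¹ * g⁻¹ * (a⁻¹ * b⁻¹ * a * b)⁻¹⁻¹ * g⁻¹⁻¹ := by group
  rw [h3]
  exact h2

theorem commPowSubgroup_le_center (p : ℕ) {r : ℕ} {C : Fin r → Type u} [∀ i, Group (C i)]
    (x : ∀ i, C i) (β : Fin r → Fin r → ℕ) :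
    commPowSubgroup p x β ≤ Subgroup.center (NilpotentProduct 2 C) := by
  refine (Subgroup.closure_le _).2 ?_
  rintro g ⟨i, j, -, rfl⟩
  exact pow_mem (groupComm_mem_center C _ _) _

instance commPowSubgroup_normal (p : ℕ) {r : ℕ} {C : Fin r → Type u} [∀ i, Group (C i)]
    (x : ∀ i, C i) (β : Fin r → Fin r → ℕ) : (commPowSubgroup p x β).Normal where
  conj_mem n hn g := by
    have h := Subgroup.mem_center_iff.1 (commPowSubgroup_le_center p x β hn) g
    rwa [h, mul_inv_cancel_right]

/-! `IsClassTwoPresented` isolates what matters about G: it is universal among class-two groups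
obeying the given bounds on generators and commutators.

Necessity: put a = α_{r-1} (a = 0 if r = 1) and suppose a < α_r. If H/Z(H) ≅ G, then H has class at
most three, and power formulas for odd exponents (`commute_pow_of_odd`) make the p^a-th power of a
lift of x_r commute with lifts of all generators. It is therefore central, so x_r^(p^a) = 1 in G,
which a map onto a cyclic group of order p^α_r refutes.

Sufficiency: by `isCapable_of_noncommuting_lifts` each g ≠ 1 may be detected separately, here with H
a `ShiftGroup` over ZMod (p^m). An element has exponents mod p^α_i on the generators and, if those
vanish, exponents mod p^β_ji on the commutators; `exists_hom_generator` detects the former,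
`exists_hom_commutator` the latter. Only the former needs α_{r-1} = α_r: each i must have a partner
j ≠ i with α_i ≤ α_j. -/

open scoped commutatorElement

/-! ### Commutators and generating sets -/

section Commutators

variable {G : Type*} [Group G]

theorem groupComm_eq_commutatorElement (a b : G) : groupComm a b = ⁅a⁻¹, b⁻¹⁆ := by
  simp [groupComm, commutatorElement_def]

theorem map_groupComm {H : Type*} [Group H] (f : G →* H) (a b : G) :
    f (groupComm a b) = groupComm (f a) (f b) := by
  simp [groupComm]

theorem groupComm_eq_one_of_commute {a b : G} (h : Commute a b) : groupComm a b = 1 := by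
  rw [groupComm_eq_commutatorElement, commutatorElement_eq_one_iff_commute]
  exact h.inv_inv

theorem lowerCentralSeries_two_eq_bot (h : ∀ a b : G, groupComm a b ∈ Subgroup.center G) :
    (⊤ : Subgroup G).lowerCentralSeries 2 = ⊥ := by
  rw [Subgroup.lowerCentralSeries_succ, Subgroup.top_lowerCentralSeries_one, eq_bot_iff]
  have hc : commutator G ≤ Subgroup.center G := by
    rw [commutator_def, Subgroup.commutator_le]
    intro a _ b _
    simpa [groupComm_eq_commutatorElement] using h a⁻¹ b⁻¹
  rw [Subgroup.commutator_le]
  intro a ha b _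
  rw [Subgroup.mem_bot, commutatorElement_eq_one_iff_commute]
  exact (Subgroup.mem_center_iff.1 (hc ha) b).symm

theorem mem_center_of_closure_eq_top {S : Set G} (hS : Subgroup.closure S = ⊤) {z : G}
    (hz : ∀ s ∈ S, Commute s z) : z ∈ Subgroup.center G := by
  have : Subgroup.closure S ≤ Subgroup.centralizer {z} := by
    rw [Subgroup.closure_le]
    intro s hs
    rw [SetLike.mem_coe, Subgroup.mem_centralizer_singleton_iff]
    exact hz s hs
  rw [hS] at this
  rw [Subgroup.mem_center_iff]
  intro g
  exact Subgroup.mem_centralizer_singleton_iff.1 (this (Subgroup.mem_top g))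

theorem commute_of_closure_eq_top {S : Set G} (hS : Subgroup.closure S = ⊤)
    (h : ∀ s ∈ S, ∀ t ∈ S, Commute s t) (a b : G) : Commute a b := by
  have hc : (⊤ : Subgroup G) ≤ Subgroup.center G := by
    rw [← hS, Subgroup.closure_le]
    intro t ht
    exact mem_center_of_closure_eq_top hS fun s hs => h s hs t ht
  exact Subgroup.mem_center_iff.1 (hc (Subgroup.mem_top b)) a

/-- Modulo E the generators commute, so the quotient is abelian. -/
theorem commutator_le_of_closure_eq_top {S : Set G} (hS : Subgroup.closure S = ⊤)
    (E : Subgroup G) [E.Normal] (h : ∀ s ∈ S, ∀ t ∈ S, groupComm s t ∈ E) :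
    commutator G ≤ E := by
  rw [← Subgroup.Normal.quotient_commutative_iff_commutator_le]
  refine ⟨⟨fun a b => ?_⟩⟩
  have hS' : Subgroup.closure (QuotientGroup.mk' E '' S) = ⊤ := by
    rw [← MonoidHom.map_closure, hS, Subgroup.map_top_of_surjective _
      (QuotientGroup.mk'_surjective E)]
  refine commute_of_closure_eq_top hS' ?_ a b
  rintro _ ⟨s, hs, rfl⟩ _ ⟨t, ht, rfl⟩
  have h1 : QuotientGroup.mk' E (groupComm s t) = 1 :=
    (QuotientGroup.eq_one_iff _).2 (h s hs t ht)
  rw [map_groupComm, groupComm_eq_commutatorElement, commutatorElement_eq_one_iff_commute] at h1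
  simpa using h1.inv_inv

end Commutators

/-! ### The universal property of G -/

/-- `G` is the universal group of class at most two on generators `y i` of orders dividing
`p ^ α i`, whose commutators `[y j, y i]`, `i < j`, have orders dividing `p ^ β j i`. -/
structure IsClassTwoPresented {r : ℕ} (p : ℕ) (α : Fin r → ℕ) (β : Fin r → Fin r → ℕ)
    {G : Type u} [Group G] (y : Fin r → G) : Prop where
  closure_range : Subgroup.closure (Set.range y) = ⊤
  groupComm_mem : ∀ a b : G, groupComm a b ∈ Subgroup.center G
  pow_eq_one : ∀ i, y i ^ p ^ α i = 1
  groupComm_pow_eq_one : ∀ i j, i < j → groupComm (y j) (y i) ^ p ^ β j i = 1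
  exists_hom : ∀ (Q : Type) [Group Q] (z : Fin r → Q),
    (∀ a b : Q, groupComm a b ∈ Subgroup.center Q) → (∀ i, z i ^ p ^ α i = 1) →
    (∀ i j, i < j → groupComm (z j) (z i) ^ p ^ β j i = 1) → ∃ f : G →* Q, ∀ i, f (y i) = z i

theorem isClassTwoPresented_nilpotentProduct {p r : ℕ} {C : Fin r → Type u} [∀ i, Group (C i)]
    (x : ∀ i, C i) (hx : ∀ i, Subgroup.zpowers (x i) = ⊤)
    (α : Fin r → ℕ) (hord : ∀ i, orderOf (x i) = p ^ α i) (β : Fin r → Fin r → ℕ) :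
    IsClassTwoPresented p α β (fun i => QuotientGroup.mk' (commPowSubgroup p x β)
      (NilpotentProduct.inc 2 C i (x i))) where
  closure_range := by
    have h1 : Subgroup.closure (Set.range fun i => (Monoid.CoprodI.of (x i) : Monoid.CoprodI C))
        = ⊤ := by
      rw [eq_top_iff]
      intro g _
      induction g using Monoid.CoprodI.induction_on with
      | one => exact one_mem _
      | of i m =>
        obtain ⟨k, rfl⟩ : m ∈ Subgroup.zpowers (x i) := by rw [hx]; trivial
        simp only [map_zpow]
        exact zpow_mem (Subgroup.subset_closure (Set.mem_range_self i)) k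
      | mul a b ha hb => exact mul_mem (ha trivial) (hb trivial)
    have h2 := congrArg (Subgroup.map ((QuotientGroup.mk' (commPowSubgroup p x β)).comp
      (QuotientGroup.mk' ((⊤ : Subgroup (Monoid.CoprodI C)).lowerCentralSeries 2)))) h1
    rw [MonoidHom.map_closure, Subgroup.map_top_of_surjective, ← Set.range_comp] at h2
    · exact h2
    · exact (QuotientGroup.mk'_surjective _).comp (QuotientGroup.mk'_surjective _)
  groupComm_mem a b := by
    obtain ⟨a, rfl⟩ := QuotientGroup.mk'_surjective _ a
    obtain ⟨b, rfl⟩ := QuotientGroup.mk'_surjective _ b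
    rw [← map_groupComm, Subgroup.mem_center_iff]
    intro g
    obtain ⟨g, rfl⟩ := QuotientGroup.mk'_surjective _ g
    rw [← map_mul, ← map_mul, Subgroup.mem_center_iff.1 (groupComm_mem_center C a b) g]
  pow_eq_one i := by
    rw [← map_pow, ← map_pow, ← hord, pow_orderOf_eq_one, map_one, map_one]
  groupComm_pow_eq_one i j hij := by
    rw [← map_groupComm, ← map_pow]
    exact (QuotientGroup.eq_one_iff _).2 (Subgroup.subset_closure ⟨i, j, hij, rfl⟩)
  exists_hom Q _ z hQ hz hc := by
    have hg : ∀ i (c : C i), c ∈ Subgroup.zpowers (x i) := fun i c => by rw [hx]; trivial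
    have hd : ∀ i, orderOf (z i) ∣ orderOf (x i) := fun i => by
      rw [hord]; exact orderOf_dvd_of_pow_eq_one (hz i)
    let f0 : Monoid.CoprodI C →* Q :=
      Monoid.CoprodI.lift fun i => monoidHomOfForallMemZpowers (hg i) (hd i)
    have hf0 : (⊤ : Subgroup (Monoid.CoprodI C)).lowerCentralSeries 2 ≤ f0.ker := by
      rw [← MonoidHom.comap_bot, ← Subgroup.map_le_iff_le_comap, Subgroup.map_lowerCentralSeries, ← lowerCentralSeries_two_eq_bot hQ]
      exact Subgroup.lowerCentralSeries_mono 2 le_top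
    let f1 : NilpotentProduct 2 C →* Q := QuotientGroup.lift _ f0 hf0
    have hf1 : ∀ i, f1 (NilpotentProduct.inc 2 C i (x i)) = z i := fun i => by
      change f0 (Monoid.CoprodI.of (x i)) = z i
      simp only [f0, Monoid.CoprodI.lift_of]
      exact monoidHomOfForallMemZpowers_apply_gen _ _
    have hk : commPowSubgroup p x β ≤ f1.ker := by
      refine (Subgroup.closure_le _).2 ?_
      rintro g ⟨i, j, hij, rfl⟩
      rw [SetLike.mem_coe, MonoidHom.mem_ker, map_pow, map_groupComm, hf1, hf1, hc i j hij]
    exact ⟨QuotientGroup.lift _ f1 hk, fun i => hf1 i⟩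

/-! ### Capability from noncommuting lifts -/

theorem commute_of_mk_eq_mk {H : Type*} [Group H] {a a' b b' : H}
    (ha : QuotientGroup.mk' (Subgroup.center H) a = QuotientGroup.mk' _ a')
    (hb : QuotientGroup.mk' (Subgroup.center H) b = QuotientGroup.mk' _ b')
    (h : Commute a b) : Commute a' b' := by
  have hz : ∀ {z : H}, z ∈ Subgroup.center H → ∀ g : H, Commute z g := fun hz g =>
    (Subgroup.mem_center_iff.1 hz g).symm
  have ha1 := hz (QuotientGroup.eq.1 ha)
  have hb1 := hz (QuotientGroup.eq.1 hb)
  have h1 : Commute (a * (a⁻¹ * a')) (b * (b⁻¹ * b')) :=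
    (h.mul_left (ha1 b)).mul_right ((hb1 _).symm)
  simpa using h1

/-- A group is capable as soon as every nontrivial element has, together with some other element,
noncommuting lifts to a group `H` along a homomorphism into `H / Z(H)`. -/
theorem isCapable_of_noncommuting_lifts {G : Type u} [Group G]
    (h : ∀ g : G, g ≠ 1 → ∃ (H : Type) (_ : Group H) (f : G →* H ⧸ Subgroup.center H) (g' : G)
      (a b : H), QuotientGroup.mk' _ a = f g ∧ QuotientGroup.mk' _ b = f g' ∧ ¬ Commute a b) :
    IsCapable G := by
  have h' : ∀ s : {g : G // g ≠ 1}, ∃ (H : Type) (_ : Group H) (f : G →* H ⧸ Subgroup.center H)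
      (g' : G), ∀ a b : H, QuotientGroup.mk' _ a = f s.1 → QuotientGroup.mk' _ b = f g' →
        ¬ Commute a b := fun s => by
    obtain ⟨H, inst, f, g', a, b, ha, hb, hab⟩ := h s.1 s.2
    refine ⟨H, inst, f, g', fun a' b' ha' hb' hc => hab ?_⟩
    exact commute_of_mk_eq_mk (ha'.trans ha.symm) (hb'.trans hb.symm) hc
  choose H inst f g' hne using h'
  -- The fibre product of G with all the H s over the quotients H s / Z(H s). Its projection to G is
  -- onto, and the noncommuting lifts force the kernel to be the whole centre.
  let P : Subgroup (G × ∀ s, H s) :=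
    { carrier := {q | ∀ s, QuotientGroup.mk' (Subgroup.center (H s)) (q.2 s) = f s q.1}
      mul_mem' := fun {a b} ha hb s => by
        simp only [Prod.snd_mul, Prod.fst_mul, Pi.mul_apply, map_mul]
        rw [ha s, hb s]
      one_mem' := fun s => by simp
      inv_mem' := fun {a} ha s => by
        simp only [Prod.snd_inv, Prod.fst_inv, Pi.inv_apply, map_inv]
        rw [ha s] }
  have lift : ∀ g : G, ∃ q : P, q.1.1 = g := fun g => by
    choose b hb using fun s => QuotientGroup.mk'_surjective (Subgroup.center (H s)) (f s g)
    exact ⟨⟨(g, b), hb⟩, rfl⟩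
  let π : P →* G := (MonoidHom.fst G (∀ s, H s)).comp P.subtype
  have hker : π.ker = Subgroup.center P := by
    ext q
    rw [MonoidHom.mem_ker, Subgroup.mem_center_iff]
    constructor
    · intro hq t
      have hq1 : q.1.1 = 1 := hq
      refine Subtype.ext (Prod.ext ?_ (funext fun s => ?_))
      · change t.1.1 * q.1.1 = q.1.1 * t.1.1
        rw [hq1, mul_one, one_mul]
      · have h1 := q.2 s
        rw [hq1, map_one] at h1
        exact Subgroup.mem_center_iff.1 ((QuotientGroup.eq_one_iff _).1 h1) (t.1.2 s)
    · intro hq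
      by_contra hq1
      obtain ⟨t, ht⟩ := lift (g' ⟨q.1.1, hq1⟩)
      refine hne ⟨q.1.1, hq1⟩ (q.1.2 ⟨q.1.1, hq1⟩) (t.1.2 ⟨q.1.1, hq1⟩) (q.2 _) ?_ ?_
      · rw [← ht]
        exact t.2 _
      · exact (congrArg (fun z : P => z.1.2 ⟨q.1.1, hq1⟩) (hq t)).symm
  exact ⟨P, inferInstance, ⟨(QuotientGroup.quotientKerEquivOfSurjective π lift).symm.trans
    (QuotientGroup.quotientMulEquivOfEq hker)⟩⟩

/-! ### A class-three test group -/

/-- The semidirect product of `R ^ 3` by `R`, where `k` acts by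
`(v₀, v₁, v₂) ↦ (v₀, v₁ + k v₀, v₂ + 2 k v₁ + k² v₀)`. -/
@[ext]
structure ShiftGroup (R : Type v) where
  k : R
  v0 : R
  v1 : R
  v2 : R

namespace ShiftGroup

variable {R : Type v} [CommRing R]

instance : Mul (ShiftGroup R) :=
  ⟨fun g h => ⟨g.k + h.k, g.v0 + h.v0, g.v1 + h.v1 + g.k * h.v0,
    g.v2 + h.v2 + 2 * g.k * h.v1 + g.k ^ 2 * h.v0⟩⟩

instance : One (ShiftGroup R) := ⟨⟨0, 0, 0, 0⟩⟩

instance : Inv (ShiftGroup R) :=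
  ⟨fun g => ⟨-g.k, -g.v0, -g.v1 + g.k * g.v0, -g.v2 + 2 * g.k * g.v1 - g.k ^ 2 * g.v0⟩⟩

@[simp] theorem mul_def (g h : ShiftGroup R) : g * h = ⟨g.k + h.k, g.v0 + h.v0,
    g.v1 + h.v1 + g.k * h.v0, g.v2 + h.v2 + 2 * g.k * h.v1 + g.k ^ 2 * h.v0⟩ := rfl

@[simp] theorem one_def : (1 : ShiftGroup R) = ⟨0, 0, 0, 0⟩ := rfl

@[simp] theorem inv_def (g : ShiftGroup R) : g⁻¹ = ⟨-g.k, -g.v0, -g.v1 + g.k * g.v0,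
    -g.v2 + 2 * g.k * g.v1 - g.k ^ 2 * g.v0⟩ := rfl

instance : Group (ShiftGroup R) where
  mul_assoc a b c := by
    ext <;> simp <;> ring
  one_mul a := by ext <;> simp
  mul_one a := by ext <;> simp
  inv_mul_cancel a := by
    ext <;> simp
    ring

theorem center_mk (z : R) : (⟨0, 0, 0, z⟩ : ShiftGroup R) ∈ Subgroup.center (ShiftGroup R) := by
  rw [Subgroup.mem_center_iff]
  intro g
  ext <;> simp [add_comm]

theorem mk_eq_mk {a b : ShiftGroup R} (hk : a.k = b.k) (h0 : a.v0 = b.v0) (h1 : a.v1 = b.v1) :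
    QuotientGroup.mk' (Subgroup.center (ShiftGroup R)) a = QuotientGroup.mk' _ b := by
  refine QuotientGroup.eq.2 ?_
  have : a⁻¹ * b = ⟨0, 0, 0, b.v2 - a.v2⟩ := by
    ext
    · simp [hk]
    · simp [h0]
    · simp [hk, h0, h1]
    · simp [hk, h0, h1]; ring
  rw [this]
  exact center_mk _

/-- The quotient of the shift group by its center has class at most two. -/
theorem groupComm_mem_center (a b : ShiftGroup R ⧸ Subgroup.center (ShiftGroup R)) :
    groupComm a b ∈ Subgroup.center (ShiftGroup R ⧸ Subgroup.center (ShiftGroup R)) := by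
  obtain ⟨a, rfl⟩ := QuotientGroup.mk'_surjective _ a
  obtain ⟨b, rfl⟩ := QuotientGroup.mk'_surjective _ b
  rw [Subgroup.mem_center_iff]
  intro g
  obtain ⟨g, rfl⟩ := QuotientGroup.mk'_surjective _ g
  simp only [groupComm, ← map_mul, ← map_inv]
  apply mk_eq_mk <;> simp <;> ring

theorem pow_k (k : R) (n : ℕ) : (⟨k, 0, 0, 0⟩ : ShiftGroup R) ^ n = ⟨n * k, 0, 0, 0⟩ := by
  induction n with
  | zero => simp
  | succ n ih => rw [pow_succ, ih]; ext <;> simp; ring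

theorem pow_v0 (a : R) (n : ℕ) : (⟨0, a, 0, 0⟩ : ShiftGroup R) ^ n = ⟨0, n * a, 0, 0⟩ := by
  induction n with
  | zero => simp
  | succ n ih => rw [pow_succ, ih]; ext <;> simp; ring

theorem mk_pow (k b : R) (n : ℕ) :
    QuotientGroup.mk' (Subgroup.center (ShiftGroup R)) (⟨k, 0, b, 0⟩ ^ n) =
      QuotientGroup.mk' _ ⟨n * k, 0, n * b, 0⟩ := by
  induction n with
  | zero => simp
  | succ n ih =>
    rw [pow_succ, map_mul, ih, ← map_mul]
    apply mk_eq_mk <;> simp <;> ring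

/-- The commutator is 2k in the last coordinate, which is central and so invisible in the quotient.
-/
theorem not_commute_of_k {a : ShiftGroup R} (ha : 2 * a.k ≠ 0) :
    ¬ Commute a ⟨0, 0, 1, 0⟩ := fun h => ha <| by
  have h2 := congrArg ShiftGroup.v2 h.eq
  simpa using h2

theorem not_commute_of_v1 {b : R} (hb : 2 * b ≠ 0) :
    ¬ Commute (⟨0, 0, b, 0⟩ : ShiftGroup R) ⟨1, 0, 0, 0⟩ := fun h => hb <| by
  have h2 := congrArg ShiftGroup.v2 h.eq
  simpa using h2.symm

end ShiftGroup

/-! ### Powers of products in class three -/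

section Powers

variable {H : Type*} [Group H]

theorem pow_mul_eq_mul_pow_mul {v d e : H} (h : d * v = v * d * e) (he : ∀ g, Commute e g)
    (n : ℕ) : d ^ n * v = v * d ^ n * e ^ n := by
  induction n with
  | zero => simp
  | succ n ih =>
    calc d ^ (n + 1) * v = d ^ n * (d * v) := by rw [pow_succ]; group
      _ = d ^ n * v * d * e := by rw [h]; group
      _ = v * d ^ n * (e ^ n * d) * e := by rw [ih]; group
      _ = v * d ^ (n + 1) * e ^ (n + 1) := by
        rw [((he d).pow_left n).eq, pow_succ, pow_succ]; group

theorem mul_pow_of_central_commutator {v d e : H} (h : d * v = v * d * e)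
    (he : ∀ g, Commute e g) (n : ℕ) : (v * d) ^ n = v ^ n * d ^ n * e ^ n.choose 2 := by
  induction n with
  | zero => simp
  | succ n ih =>
    have hc : (n + 1).choose 2 = n + n.choose 2 := by simp [Nat.choose_succ_succ' n 1]
    calc (v * d) ^ (n + 1) = v ^ n * d ^ n * (e ^ n.choose 2 * (v * d)) := by
          rw [pow_succ, ih]; group
      _ = v ^ n * (d ^ n * v) * d * e ^ n.choose 2 := by
          rw [((he (v * d)).pow_left _).eq]; group
      _ = v ^ n * v * d ^ n * (e ^ n * d) * e ^ n.choose 2 := by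
          rw [pow_mul_eq_mul_pow_mul h he]; group
      _ = v ^ (n + 1) * d ^ (n + 1) * e ^ (n + 1).choose 2 := by
          rw [((he d).pow_left n).eq, hc, pow_add, pow_succ, pow_succ]; group

theorem Nat.dvd_choose_two_of_odd {n : ℕ} (hn : Odd n) : n ∣ n.choose 2 := by
  obtain ⟨m, rfl⟩ := hn
  refine ⟨m, ?_⟩
  rw [Nat.choose_two_right, Nat.add_sub_cancel]
  exact Nat.div_eq_of_eq_mul_left two_pos (by ring)

/-- Since d ^ n commutes with v, e ^ n = 1; for odd n the exponent n.choose 2 of e is a multiple of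
n. -/
theorem mul_pow_of_odd {v d e : H} (h : d * v = v * d * e) (he : ∀ g, Commute e g) {n : ℕ}
    (hn : Odd n) (hd : Commute (d ^ n) v) : (v * d) ^ n = v ^ n * d ^ n := by
  have h1 : e ^ n = 1 := by
    have h2 := pow_mul_eq_mul_pow_mul h he n
    rw [hd.eq] at h2
    exact left_eq_mul.1 h2
  obtain ⟨m, hm⟩ := Nat.dvd_choose_two_of_odd hn
  rw [mul_pow_of_central_commutator h he, hm, pow_mul, h1, one_pow, mul_one]

/-- In a group of class three, `u ^ n` commutes with `v` if `n` is odd and `v ^ n` and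
`[v, u] ^ n` are central. -/
theorem commute_pow_of_odd {u v : H} {n : ℕ} (hn : Odd n)
    (hc : ∀ g h, Commute (groupComm (groupComm v u) g) h)
    (hv : ∀ g, Commute (v ^ n) g) (hvu : ∀ g, Commute (groupComm v u ^ n) g) :
    Commute v (u ^ n) := by
  have hc' : ∀ g h, Commute (groupComm (groupComm v u)⁻¹ g) h := fun g h => by
    have h1 : groupComm (groupComm v u)⁻¹ g =
        groupComm v u * (groupComm (groupComm v u) g)⁻¹ * (groupComm v u)⁻¹ := by
      simp only [groupComm]; group
    rw [h1, ((hc g (groupComm v u)).inv_left.symm).eq, mul_assoc, mul_inv_cancel, mul_one]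
    exact (hc g h).inv_left
  set d := groupComm v u with hd
  have h1 : u⁻¹ * v * u = v * d := by rw [hd, groupComm]; group
  have h2 : v⁻¹ * u * v = u * d⁻¹ := by rw [hd, groupComm]; group
  -- Computing (u⁻¹ v u) ^ n = (v d) ^ n in two ways gives d ^ n = 1; then (v⁻¹ u v) ^ n = (u d⁻¹) ^
  -- n = u ^ n.
  have h3 := mul_pow_of_odd (v := v) (d := d) (e := groupComm d v)
    (by simp only [groupComm]; group) (hc v) hn (hvu v)
  have h4 : (u⁻¹ * v * u) ^ n = v ^ n := by
    have := conj_pow (i := n) (a := u⁻¹) (b := v)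
    rw [inv_inv] at this
    rw [this, ← (hv u⁻¹).eq, inv_mul_cancel_right]
  have h5 : d ^ n = 1 := by
    rw [← h1, h4] at h3
    exact left_eq_mul.1 h3
  have h6 := mul_pow_of_odd (v := u) (d := d⁻¹) (e := groupComm d⁻¹ u)
    (by simp only [groupComm]; group) (hc' u) hn (by rw [inv_pow, h5, inv_one]; exact .one_left _)
  rw [← h2, inv_pow, h5, inv_one, mul_one] at h6
  have h7 := conj_pow (i := n) (a := v⁻¹) (b := u)
  rw [inv_inv, h6] at h7
  calc v * u ^ n = v * (v⁻¹ * u ^ n * v) := by rw [← h7]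
    _ = u ^ n * v := by group

end Powers

/-! ### Necessity -/

theorem IsClassTwoPresented.not_isCapable {p r : ℕ} (hp : p.Prime) (hodd : p ≠ 2)
    {α : Fin r → ℕ} {β : Fin r → Fin r → ℕ} {G : Type u} [Group G] {y : Fin r → G}
    (hG : IsClassTwoPresented p α β y) (hβ : ∀ i j : Fin r, i < j → β j i ≤ α i)
    (l : Fin r) (a : ℕ) (ha : a < α l) (hl : ∀ i, i ≠ l → i < l ∧ α i ≤ a) : ¬ IsCapable G := by
  rintro ⟨H, _, ⟨e⟩⟩
  have hn : Odd (p ^ a) := (hp.odd_of_ne_two hodd).pow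
  let π : H →* G := e.symm.toMonoidHom.comp (QuotientGroup.mk' (Subgroup.center H))
  have hπ : Function.Surjective π := e.symm.surjective.comp (QuotientGroup.mk'_surjective _)
  have hker : ∀ h : H, π h = 1 ↔ h ∈ Subgroup.center H := fun h => by
    change e.symm (QuotientGroup.mk' _ h) = 1 ↔ _
    rw [map_eq_one_iff e.symm e.symm.injective]
    exact QuotientGroup.eq_one_iff h
  have hcomm : ∀ h : H, π h = 1 → ∀ g, Commute h g := fun h hh g =>
    (Subgroup.mem_center_iff.1 ((hker h).1 hh) g).symm
  choose s hs using fun i => hπ (y i)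
  have key : ∀ i, Commute (s i) (s l ^ p ^ a) := fun i => by
    rcases eq_or_ne i l with rfl | hi
    · exact (Commute.refl _).pow_right _
    obtain ⟨hil, hia⟩ := hl i hi
    have hy : y i ^ p ^ a = 1 := by
      obtain ⟨m, hm⟩ := pow_dvd_pow p hia
      rw [hm, pow_mul, hG.pow_eq_one, one_pow]
    have hyc : groupComm (y l) (y i) ^ p ^ a = 1 := by
      obtain ⟨m, hm⟩ := pow_dvd_pow p ((hβ i l hil).trans hia)
      rw [hm, pow_mul, hG.groupComm_pow_eq_one i l hil, one_pow]
    refine commute_pow_of_odd hn (fun g => hcomm _ ?_) (hcomm _ ?_) (hcomm _ ?_)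
    · rw [map_groupComm, map_groupComm]
      exact groupComm_eq_one_of_commute
        (Subgroup.mem_center_iff.1 (hG.groupComm_mem _ _) _).symm
    · rw [map_pow, hs, hy]
    · have hsym : groupComm (y i) (y l) = (groupComm (y l) (y i))⁻¹ := by
        simp [groupComm, mul_assoc]
      rw [map_pow, map_groupComm, hs, hs, hsym, inv_pow, hyc, inv_one]
  have hcen : s l ^ p ^ a ∈ Subgroup.center H := by
    have htop : Subgroup.closure (Set.range s ∪ Subgroup.center H) = ⊤ := by
      have h1 : (Subgroup.closure (Set.range s ∪ Subgroup.center H)).map π = ⊤ := by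
        rw [eq_top_iff, ← hG.closure_range, Subgroup.closure_le]
        rintro _ ⟨i, rfl⟩
        exact ⟨s i, Subgroup.subset_closure (Or.inl ⟨i, rfl⟩), hs i⟩
      rw [eq_top_iff]
      intro h _
      obtain ⟨h', hh', he⟩ : π h ∈ (Subgroup.closure (Set.range s ∪ Subgroup.center H)).map π := by
        rw [h1]; trivial
      have h2 : h'⁻¹ * h ∈ Subgroup.center H := by
        rw [← hker, map_mul, map_inv, he, inv_mul_cancel]
      have h3 := mul_mem hh' (Subgroup.subset_closure (Or.inr h2))
      rwa [mul_inv_cancel_left] at h3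
    refine mem_center_of_closure_eq_top htop ?_
    rintro _ (⟨i, rfl⟩ | hz)
    · exact key i
    · exact (Subgroup.mem_center_iff.1 hz _).symm
  have hy : y l ^ p ^ a = 1 := by rw [← hs, ← map_pow, hker]; exact hcen
  -- The map onto the l-th cyclic factor shows that y l has order no smaller than p ^ α l.
  obtain ⟨f, hf⟩ := hG.exists_hom (Multiplicative (ZMod (p ^ α l)))
    (fun i => if i = l then Multiplicative.ofAdd 1 else 1)
    (fun b c => by
      rw [groupComm_eq_one_of_commute (Commute.all b c)]; exact one_mem _)
    (fun i => by
      split_ifs with h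
      · rw [h, ← ofAdd_nsmul, nsmul_one, ZMod.natCast_self, ofAdd_zero]
      · exact one_pow _)
    (fun i j _ => by rw [groupComm_eq_one_of_commute (Commute.all _ _), one_pow])
  have h1 := congrArg f hy
  rw [map_pow, hf, if_pos rfl, map_one f, ← ofAdd_nsmul, nsmul_one, ofAdd_eq_one,
    ZMod.natCast_eq_zero_iff] at h1
  exact absurd ((Nat.pow_dvd_pow_iff_le_right hp.one_lt).1 h1) (not_le.2 ha)

/-! ### Sufficiency -/

theorem two_mul_ne_zero_zmod {n : ℕ} (hn : Odd n) {k : ZMod n} (hk : k ≠ 0) : 2 * k ≠ 0 := by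
  have h : IsUnit (2 : ZMod n) := by
    have := (ZMod.isUnit_iff_coprime 2 n).2 (Nat.coprime_two_left.2 hn)
    simpa using this
  rwa [Ne, h.mul_right_eq_zero]

namespace IsClassTwoPresented

variable {p r : ℕ} {α : Fin r → ℕ} {β : Fin r → Fin r → ℕ} {G : Type u} [Group G] {y : Fin r → G}

/-- The shift and the second basis vector commute modulo the centre, so no commutator relation is at
stake; `hij` makes the order of the vector divide p ^ α j. -/
theorem exists_hom_generator (hG : IsClassTwoPresented p α β y) {i j : Fin r}
    (hij : α i ≤ α j) : ∃ f : G →* ShiftGroup (ZMod (p ^ α i)) ⧸ Subgroup.center _,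
      ∀ m, f (y m) = QuotientGroup.mk' _ ⟨if m = i then 1 else 0, 0, if m = j then 1 else 0, 0⟩ := by
  refine hG.exists_hom _ _ ShiftGroup.groupComm_mem_center (fun m => ?_) (fun l m _ => ?_)
  · rw [← map_pow, ShiftGroup.mk_pow, ← map_one (QuotientGroup.mk' (Subgroup.center _))]
    apply ShiftGroup.mk_eq_mk
    · by_cases h : m = i
      · subst h
        simp
      · simp [h]
    · rfl
    · by_cases h : m = j
      · subst h
        simpa using (ZMod.natCast_eq_zero_iff _ _).2 (pow_dvd_pow p hij)
      · simp [h]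
  · rw [groupComm_eq_one_of_commute, one_pow]
    rw [commute_iff_eq, ← map_mul, ← map_mul]
    apply ShiftGroup.mk_eq_mk <;> simp [add_comm]

theorem exists_hom_commutator (hG : IsClassTwoPresented p α β y) (hmono : Monotone α)
    {i j : Fin r} (hij : i < j) (hβ : β j i ≤ α i) :
    ∃ f : G →* ShiftGroup (ZMod (p ^ β j i)) ⧸ Subgroup.center _,
      f (y i) = QuotientGroup.mk' _ ⟨1, 0, 0, 0⟩ ∧
      ∀ l m, l < m → f (groupComm (y m) (y l)) =
        QuotientGroup.mk' _ ⟨0, 0, if l = i ∧ m = j then 1 else 0, 0⟩ := by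
  -- The sign -1 makes [w j, w i] have v1 equal to 1; this vector does not commute with the shift.
  let w : Fin r → ShiftGroup (ZMod (p ^ β j i)) := fun m =>
    ⟨if m = i then 1 else 0, if m = j then -1 else 0, 0, 0⟩
  have hw : ∀ l m, l < m → groupComm (QuotientGroup.mk' (Subgroup.center _) (w m))
      (QuotientGroup.mk' (Subgroup.center _) (w l)) =
        QuotientGroup.mk' _ ⟨0, 0, if l = i ∧ m = j then 1 else 0, 0⟩ := fun l m hlm => by
    rw [← map_groupComm]
    have h1 : ¬ (m = i ∧ l = j) := by
      rintro ⟨rfl, rfl⟩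
      exact lt_asymm hij hlm
    apply ShiftGroup.mk_eq_mk
    · simp [groupComm, w]
    · simp [groupComm, w]
    · by_cases hl : l = i <;> by_cases hm : m = j <;> by_cases hl' : l = j <;>
        by_cases hm' : m = i <;> simp_all [groupComm, w]
  obtain ⟨f, hf⟩ := hG.exists_hom _ (fun m => QuotientGroup.mk' (Subgroup.center _) (w m))
    ShiftGroup.groupComm_mem_center (fun m => by
      rw [← map_pow]
      have hz : ∀ l, i ≤ l → ((p ^ α l : ℕ) : ZMod (p ^ β j i)) = 0 := fun l hl =>
        (ZMod.natCast_eq_zero_iff _ _).2 (pow_dvd_pow p (hβ.trans (hmono hl)))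
      have h1 : w m ^ p ^ α m = 1 := by
        by_cases h : m = i
        · subst h
          simp only [w, if_true, if_neg hij.ne, ShiftGroup.pow_k, hz m le_rfl, zero_mul,
            ShiftGroup.one_def]
        · by_cases h' : m = j
          · subst h'
            simp only [w, if_true, if_neg h, ShiftGroup.pow_v0, hz m hij.le, zero_mul,
              ShiftGroup.one_def]
          · have : w m = 1 := by simp [w, h, h']
            rw [this, one_pow]
      rw [h1, map_one]) (fun l m hlm => by
      rw [hw l m hlm, ← map_pow, ShiftGroup.mk_pow, ← map_one (QuotientGroup.mk' (Subgroup.center _))]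
      apply ShiftGroup.mk_eq_mk
      · simp
      · rfl
      · by_cases h : l = i ∧ m = j
        · obtain ⟨rfl, rfl⟩ := h
          simp
        · simp [h])
  refine ⟨f, ?_, fun l m hlm => ?_⟩
  · rw [hf]
    simp [w, hij.ne]
  · rw [map_groupComm, hf, hf, hw l m hlm]

open scoped IsMulCommutative in
theorem isCapable (hG : IsClassTwoPresented p α β y) (hp : p.Prime) (hodd : p ≠ 2)
    (hmono : Monotone α) (hβ : ∀ i j : Fin r, i < j → β j i ≤ α i)
    (hα : ∀ i, ∃ j, j ≠ i ∧ α i ≤ α j) : IsCapable G := by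
  have hpodd : Odd p := hp.odd_of_ne_two hodd
  choose t hti hαt using hα
  choose f hf using fun i => hG.exists_hom_generator (hαt i)
  -- Values in the centre, a commutative group, allow unordered products.
  let c : {q : Fin r × Fin r // q.1 < q.2} → Subgroup.center G := fun q =>
    ⟨groupComm (y q.1.2) (y q.1.1), hG.groupComm_mem _ _⟩
  choose F hF1 hF2 using fun q : {q : Fin r × Fin r // q.1 < q.2} =>
    hG.exists_hom_commutator hmono q.2 (hβ _ _ q.2)
  have coords : ∀ g : G, ∃ a : Fin r → ℤ,
      Abelianization.of g = ∏ m, Abelianization.of (y m) ^ a m ∧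
        ∀ i, ∃ h, QuotientGroup.mk' _ h = f i g ∧ h.k = a i := fun g => by
    have hg : g ∈ Subgroup.closure (Set.range y) := by rw [hG.closure_range]; trivial
    induction hg using Subgroup.closure_induction with
    | mem _ hx =>
      obtain ⟨l, rfl⟩ := hx
      refine ⟨Pi.single l 1, ?_, fun i => ⟨_, (hf i l).symm, ?_⟩⟩
      · rw [Finset.prod_eq_single l]
        · simp
        · intro m _ hm
          simp [hm]
        · simp
      · by_cases h : i = l
        · subst h; simp
        · simp [h, Ne.symm h]
    | one => exact ⟨0, by simp, fun i => ⟨1, by rw [map_one, map_one], by simp⟩⟩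
    | mul g g' _ _ hg hg' =>
      obtain ⟨a, ha, hh⟩ := hg
      obtain ⟨a', ha', hh'⟩ := hg'
      refine ⟨a + a', ?_, fun i => ?_⟩
      · rw [map_mul, ha, ha', ← Finset.prod_mul_distrib]
        exact Finset.prod_congr rfl fun m _ => (zpow_add _ _ _).symm
      · obtain ⟨h, h1, h2⟩ := hh i
        obtain ⟨h', h1', h2'⟩ := hh' i
        exact ⟨h * h', by rw [map_mul, map_mul, h1, h1'], by simp [h2, h2']⟩
    | inv g _ hg =>
      obtain ⟨a, ha, hh⟩ := hg
      refine ⟨-a, ?_, fun i => ?_⟩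
      · rw [map_inv, ha, ← Finset.prod_inv_distrib]
        exact Finset.prod_congr rfl fun m _ => (zpow_neg _ _).symm
      · obtain ⟨h, h1, h2⟩ := hh i
        exact ⟨h⁻¹, by rw [map_inv, map_inv, h1], by simp [h2]⟩
  set E : Subgroup G := Subgroup.closure (Set.range fun q => (c q : G)) with hE
  have hEc : E ≤ Subgroup.center G := by
    rw [hE, Subgroup.closure_le]
    rintro _ ⟨q, rfl⟩
    exact (c q).2
  have : E.Normal := ⟨fun n hn g => by
    rwa [Subgroup.mem_center_iff.1 (hEc hn) g, mul_inv_cancel_right]⟩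
  have hcE : commutator G ≤ E := by
    refine commutator_le_of_closure_eq_top hG.closure_range E ?_
    rintro _ ⟨l, rfl⟩ _ ⟨m, rfl⟩
    rcases lt_trichotomy l m with h | rfl | h
    · have h1 : groupComm (y l) (y m) = (c ⟨(l, m), h⟩ : G)⁻¹ := by
        simp [c, groupComm, mul_assoc]
      rw [h1]
      exact inv_mem (Subgroup.subset_closure ⟨_, rfl⟩)
    · rw [groupComm_eq_one_of_commute (Commute.refl _)]
      exact one_mem _
    · exact Subgroup.subset_closure ⟨⟨(m, l), h⟩, rfl⟩
  have coordsE : ∀ g ∈ E, ∃ b : {q : Fin r × Fin r // q.1 < q.2} → ℤ,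
      g = ((∏ q, c q ^ b q : Subgroup.center G) : G) ∧
        ∀ q, QuotientGroup.mk' _ ⟨0, 0, (b q : ZMod _), 0⟩ = F q g := fun g hg => by
    induction hg using Subgroup.closure_induction with
    | mem _ hx =>
      obtain ⟨l, rfl⟩ := hx
      refine ⟨Pi.single l 1, ?_, fun q => ?_⟩
      · rw [Finset.prod_eq_single l]
        · simp
        · intro m _ hm
          simp [hm]
        · simp
      · refine Eq.trans ?_ (hF2 q _ _ l.2).symm
        congr 2
        by_cases h : q = l
        · subst h; simp
        · have : ¬ (l.1.1 = q.1.1 ∧ l.1.2 = q.1.2) := fun h' =>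
            h (Subtype.ext (Prod.ext h'.1.symm h'.2.symm))
          simp [h, this]
    | one => exact ⟨0, by simp, fun q => by rw [map_one]; simp [← ShiftGroup.one_def]⟩
    | mul g g' _ _ hg hg' =>
      obtain ⟨b, hb, hh⟩ := hg
      obtain ⟨b', hb', hh'⟩ := hg'
      refine ⟨b + b', ?_, fun q => ?_⟩
      · rw [hb, hb', ← Subgroup.coe_mul, ← Finset.prod_mul_distrib]
        exact congrArg _ (Finset.prod_congr rfl fun m _ => (zpow_add _ _ _).symm)
      · rw [map_mul, ← hh, ← hh', ← map_mul]
        apply ShiftGroup.mk_eq_mk <;> simp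
    | inv g _ hg =>
      obtain ⟨b, hb, hh⟩ := hg
      refine ⟨-b, ?_, fun q => ?_⟩
      · rw [hb, ← Subgroup.coe_inv, ← Finset.prod_inv_distrib]
        exact congrArg _ (Finset.prod_congr rfl fun m _ => (zpow_neg _ _).symm)
      · rw [map_inv, ← hh, ← map_inv]
        apply ShiftGroup.mk_eq_mk <;> simp
  have zpow_eq_one : ∀ {K : Type u} [Group K] {k : K} {n : ℕ} {z : ℤ}, k ^ n = 1 →
      (z : ZMod n) = 0 → k ^ z = 1 := fun {K} _ {k} {n} {z} hk hz => by
    obtain ⟨m, rfl⟩ := (ZMod.intCast_zmod_eq_zero_iff_dvd z n).1 hz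
    rw [zpow_mul, zpow_natCast, hk, one_zpow]
  refine isCapable_of_noncommuting_lifts fun g hg => ?_
  obtain ⟨a, ha, hh⟩ := coords g
  -- If every generator exponent vanishes, g is trivial in the abelianization and so lies in E,
  -- where the commutator exponents decide.
  by_cases hai : ∃ i, (a i : ZMod (p ^ α i)) ≠ 0
  · obtain ⟨i, hi⟩ := hai
    obtain ⟨h, h1, h2⟩ := hh i
    refine ⟨_, inferInstance, f i, y (t i), h, ⟨0, 0, 1, 0⟩, h1, ?_, ShiftGroup.not_commute_of_k ?_⟩
    · rw [hf]
      simp [hti i]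
    · rw [h2]
      exact two_mul_ne_zero_zmod hpodd.pow hi
  · push Not at hai
    have hgE : g ∈ E := by
      refine hcE ?_
      rw [← Abelianization.ker_of, MonoidHom.mem_ker, ha]
      refine Finset.prod_eq_one fun m _ => zpow_eq_one ?_ (hai m)
      rw [← map_pow, hG.pow_eq_one, map_one]
    obtain ⟨b, hb, hF⟩ := coordsE g hgE
    by_cases hbq : ∃ q, (b q : ZMod (p ^ β q.1.2 q.1.1)) ≠ 0
    · obtain ⟨q, hq⟩ := hbq
      exact ⟨_, inferInstance, F q, y q.1.1, _, _, hF q, (hF1 q).symm,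
        ShiftGroup.not_commute_of_v1 (two_mul_ne_zero_zmod hpodd.pow hq)⟩
    · push Not at hbq
      refine absurd ?_ hg
      rw [hb, Finset.prod_eq_one, Subgroup.coe_one]
      exact fun q _ => zpow_eq_one
        (Subtype.ext (hG.groupComm_pow_eq_one q.1.1 q.1.2 q.2)) (hbq q)

end IsClassTwoPresented

theorem mainTheorem8 {p : ℕ} (hp : p.Prime) (hodd : p ≠ 2)
    {r : ℕ} (hr : 1 ≤ r)
    {C : Fin r → Type u} [∀ i, Group (C i)]
    (x : ∀ i, C i) (hx : ∀ i, Subgroup.zpowers (x i) = ⊤)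
    (α : Fin r → ℕ) (hord : ∀ i, orderOf (x i) = p ^ α i)
    (hα : ∀ i, 1 ≤ α i) (hmono : Monotone α)
    (β : Fin r → Fin r → ℕ) (hβ : ∀ i j : Fin r, i < j → 1 ≤ β j i ∧ β j i ≤ α i) :
    IsCapable (NilpotentProduct 2 C ⧸ commPowSubgroup p x β) ↔
      ∃ h : 1 < r, α ⟨r - 2, by omega⟩ = α ⟨r - 1, by omega⟩ := by
  have hG := isClassTwoPresented_nilpotentProduct x hx α hord β
  have hβ' : ∀ i j : Fin r, i < j → β j i ≤ α i := fun i j hij => (hβ i j hij).2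
  constructor
  · intro hcap
    by_contra hne
    rcases hr.eq_or_lt with rfl | h
    -- With a single generator, a = 0 works because α 0 ≥ 1.
    · exact hG.not_isCapable hp hodd hβ' 0 0 (hα 0)
        (fun i hi => absurd (Subsingleton.elim i 0) hi) hcap
    · refine hG.not_isCapable hp hodd hβ' ⟨r - 1, by omega⟩ (α ⟨r - 2, by omega⟩) ?_ ?_ hcap
      · exact lt_of_le_of_ne (hmono (Fin.mk_le_mk.2 (by omega))) fun he => hne ⟨h, he⟩
      · intro i hi
        have h1 : i.1 ≠ r - 1 := fun h' => hi (Fin.ext h')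
        exact ⟨Fin.lt_def.2 (by simp only; omega), hmono (Fin.le_def.2 (by simp only; omega))⟩
  · rintro ⟨h, he⟩
    refine hG.isCapable hp hodd hmono hβ' fun i => ?_
    by_cases hi : i.1 = r - 1
    · refine ⟨⟨r - 2, by omega⟩, fun h' => ?_, ?_⟩
      · have := congrArg Fin.val h'
        simp only at this
        omega
      · rw [he]
        exact hmono (Fin.le_def.2 hi.le)
    · exact ⟨⟨r - 1, by omega⟩, fun h' => hi (congrArg Fin.val h').symm,
        hmono (Fin.le_def.2 (by simp only; omega))⟩
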